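/- Let $\mathbb K$ be $\mathbb R$ or $\mathbb C$. For every positive integer $M$ there is a constant $C_M$, depending only on $M$, with the following property. Let $n,m,n_1,\dots,n_m$ be positive integers with $n_1+\cdots+n_m=M$, and let $1\le p\le\infty$ (with $1/\infty=0$). Then there is an $(n_1,\dots,n_m)$-homogeneous polynomial $$Q:\underbrace{\ell_p\times\cdots\times\ell_p}_{m}\longrightarrow\mathbb K$$ (that is, for each $j$, when all variables except the $j$-th are fixed, $Q$ is of the form $y\mapsto T(y,\dots,y)$ with $T$ an $n_j$-linear form on $\ell_p$) of the form $$Q\bigl(x^{(1)},\dots,x^{(m)}\bigr)=\sum_{t}\delta_t\prod_{j=1}^{m}\prod_{k=1}^{n_j}x^{(j)}_{t_{j,k}},$$ where $t=(t_{j,k})_{1\le j\le m,\,1\le k\le n_j}$ ranges over the $M$-tuples of indices in $\mathbb N$ and $\delta_t\in\{0,1,-1\}$, such that exactly $n^M$ of the $\delta_t$ are nonzero, different tuples $t$ with $\delta_t\ne0$ give different monomials (so the polynomial $Q$ has exactly $n^M$ nonzero monomial coefficients, all equal to $\pm1$), and $$\|Q\|:=\sup\bigl\{|Q(x^{(1)},\dots,x^{(m)})|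 : \|x^{(j)}\|_{\ell_p}\le1,\ 1\le j\le m\bigr\}\le C_M\,n^{\max\left\{M\left(\frac12-\frac1p\right)+\frac12,\;1-\frac1p\right\}}.$$ -/

import Mathlib

open scoped ENNReal

/-- `P : E → F` is a `k`-homogeneous polynomial: `P x = T (x, …, x)` for some `k`-linear map `T`. -/
def IsHomogeneousPoly (𝕂 : Type*) [RCLike 𝕂] {E F : Type*}
    [NormedAddCommGroup E] [NormedSpace 𝕂 E] [NormedAddCommGroup F] [NormedSpace 𝕂 F]
    (k : ℕ) (P : E → F) : Prop :=
  ∃ T : MultilinearMap 𝕂 (fun _ : Fin k => E) F, ∀ x : E, P x = T (fun _ => x)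

/-- `P : E₁ × ⋯ × Eₘ → F` is a `(d₁, …, dₘ)`-homogeneous polynomial: for each `i`, with all
variables but the `i`-th one fixed, `P` is a `dᵢ`-homogeneous polynomial in the `i`-th one. -/
def IsMultiHomogeneousPoly (𝕂 : Type*) [RCLike 𝕂] {m : ℕ} {E : Fin m → Type*} {F : Type*}
    [∀ j, NormedAddCommGroup (E j)] [∀ j, NormedSpace 𝕂 (E j)]
    [NormedAddCommGroup F] [NormedSpace 𝕂 F]
    (d : Fin m → ℕ) (P : (∀ j, E j) → F) : Prop :=
  ∀ (i : Fin m) (x : ∀ j, E j),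
    IsHomogeneousPoly 𝕂 (d i) (fun y : E i => P (Function.update x i y))

/-- The norm `sup { ‖P (x₁, …, xₘ)‖ : ‖x₁‖ ≤ 1, …, ‖xₘ‖ ≤ 1 }`, as an element of `[0, ∞]`
(so it is `∞`, and not a default value, for an unbounded `P`). -/
noncomputable def multipolyNorm {m : ℕ} {E : Fin m → Type*} {F : Type*}
    [∀ j, NormedAddCommGroup (E j)] [NormedAddCommGroup F] (P : (∀ j, E j) → F) : ℝ≥0∞ :=
  ⨆ (x : ∀ j, E j) (_ : ∀ j, ‖x j‖ ≤ 1), ‖P x‖ₑ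

/-- Index tuples of length `d₁ + ⋯ + dₘ`, divided into `m` blocks, the `j`-th of length `dⱼ`. -/
abbrev BlockIndex {m : ℕ} (d : Fin m → ℕ) : Type :=
  (j : Fin m) × Fin (d j) → ℕ

/-- The multi-indices `(α⁽¹⁾, …, α⁽ᵐ⁾)` of the monomial `∏ⱼ ∏ₖ x⁽ʲ⁾_{t(j,k)}` that the tuple `t`
determines: `α⁽ʲ⁾ᵢ` is the exponent of the variable `x⁽ʲ⁾ᵢ`, that is, the number of times that
`i` occurs in the `j`-th block of `t`. -/
def BlockIndex.multiIndex {m : ℕ} {d : Fin m → ℕ} (t : BlockIndex d) (j : Fin m) (i : ℕ) : ℕ :=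
  (Finset.univ.filter (fun k : Fin (d j) => t ⟨j, k⟩ = i)).card

/-! A random `M`-linear sign form on `ℂⁿ` is small. At a fixed tuple of Euclidean unit-ball vectors
it is a normalized Rademacher sum with subgaussian tails. A union bound over a `1/2`-net with at
most `5 ^ (2n)` points per variable then yields signs with norm `O(√n)` on `ℓ₂ⁿ`
(`exists_signForm_le_euclidean`).

These same signs serve every `p`. For `p ≥ 2`, rescaling from `ℓ₂ⁿ` costs `n ^ (1/2 - 1/p)` per
variable; for `p ≤ 2`, the three lines theorem interpolates with the trivial bound `1` on `ℓ₁ⁿ` and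
gives `n ^ (1 - 1/p)` (`norm_signForm_le_interp`).

To get the polynomial, the `n_j` slots of block `j` read disjoint intervals of the one sequence
`x⁽ʲ⁾`. Distinct tuples then give distinct monomials, and each restricted vector still lies in the
unit ball. -/

/-! ### Rademacher sums and the union bound -/

section Signs

variable {T : Type*} [Fintype T] [DecidableEq T]

/-- The moment generating function of a Rademacher sum is subgaussian. -/
lemma sum_exp_rademacher_le (c : T → ℝ) :
    ∑ ε : T → ℤˣ, Real.exp (∑ t, ((ε t : ℤ) : ℝ) * c t) ≤
      2 ^ Fintype.card T * Real.exp ((∑ t, c t ^ 2) / 2) := by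
  have h : ∑ ε : T → ℤˣ, Real.exp (∑ t, ((ε t : ℤ) : ℝ) * c t) =
      ∏ t, (2 * Real.cosh (c t)) := by
    simp_rw [Real.exp_sum]
    rw [← Fintype.piFinset_univ, ← Finset.prod_univ_sum (fun _ => Finset.univ)
      (fun (t : T) (u : ℤˣ) => Real.exp (((u : ℤ) : ℝ) * c t))]
    refine Finset.prod_congr rfl fun t _ => ?_
    rw [UnitsInt.univ, Finset.sum_pair (by decide), Real.cosh_eq]
    push_cast
    ring_nf
  rw [h, Finset.prod_mul_distrib, Finset.prod_const, Finset.card_univ, Finset.sum_div,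
    Real.exp_sum]
  gcongr with t
  exact Real.cosh_le_exp_half_sq _

/-- A choice of signs making finitely many normalized Rademacher sums simultaneously small. -/
lemma exists_signs_abs_sum_le {κ : Type*} [Fintype κ] (c : κ → T → ℝ)
    (hc : ∀ q, ∑ t, c q t ^ 2 ≤ 1) {r : ℝ} (hr : 0 ≤ r)
    (hκ : 2 * (Fintype.card κ : ℝ) < Real.exp (r ^ 2 / 2)) :
    ∃ ε : T → ℤˣ, ∀ q, |∑ t, ((ε t : ℤ) : ℝ) * c q t| ≤ r := by
  by_contra! hcon
  set X : (T → ℤˣ) → κ → ℝ := fun ε q => ∑ t, ((ε t : ℤ) : ℝ) * c q t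
  -- Exponential Markov with parameter `r`: if every `ε` fails at some `q`, averaging over `ε` gives
  -- `exp (r²) ≤ 2 |κ| exp (r² / 2)`, against `hκ`.
  have hlow : ∀ ε : T → ℤˣ,
      Real.exp (r ^ 2) ≤ ∑ q, (Real.exp (r * X ε q) + Real.exp (-(r * X ε q))) := by
    intro ε
    obtain ⟨q, hq⟩ := hcon ε
    have h1 : Real.exp (r ^ 2) ≤ Real.exp (r * X ε q) + Real.exp (-(r * X ε q)) := by
      rcases le_abs.1 hq.le with h | h
      · refine le_add_of_le_of_nonneg (Real.exp_le_exp.2 ?_) (Real.exp_pos _).le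
        rw [sq]; gcongr
      · refine le_add_of_nonneg_of_le (Real.exp_pos _).le (Real.exp_le_exp.2 ?_)
        rw [sq, ← mul_neg]; gcongr
    exact h1.trans (Finset.single_le_sum
      (f := fun q => Real.exp (r * X ε q) + Real.exp (-(r * X ε q)))
      (fun q _ => by positivity) (Finset.mem_univ q))
  have hmgf : ∀ (s : ℝ) (q : κ), s ^ 2 = r ^ 2 →
      ∑ ε : T → ℤˣ, Real.exp (s * X ε q) ≤ 2 ^ Fintype.card T * Real.exp (r ^ 2 / 2) := by
    intro s q hs
    have h1 := sum_exp_rademacher_le (fun t => s * c q t)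
    have h2 : ∀ ε : T → ℤˣ, s * X ε q = ∑ t, ((ε t : ℤ) : ℝ) * (s * c q t) := fun ε => by
      simp only [X, Finset.mul_sum]
      exact Finset.sum_congr rfl fun t _ => by ring
    simp_rw [h2]
    refine h1.trans ?_
    gcongr
    simp_rw [mul_pow, hs, ← Finset.mul_sum]
    exact mul_le_of_le_one_right (sq_nonneg r) (hc q)
  have hsum : (2 : ℝ) ^ Fintype.card T * Real.exp (r ^ 2) ≤
      Fintype.card κ * (2 * (2 ^ Fintype.card T * Real.exp (r ^ 2 / 2))) := by
    calc (2 : ℝ) ^ Fintype.card T * Real.exp (r ^ 2)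
        = ∑ _ε : T → ℤˣ, Real.exp (r ^ 2) := by simp
      _ ≤ ∑ ε : T → ℤˣ, ∑ q, (Real.exp (r * X ε q) + Real.exp (-(r * X ε q))) :=
          Finset.sum_le_sum fun ε _ => hlow ε
      _ = ∑ q, (∑ ε : T → ℤˣ, Real.exp (r * X ε q) +
            ∑ ε : T → ℤˣ, Real.exp ((-r) * X ε q)) := by
          rw [Finset.sum_comm]
          simp_rw [Finset.sum_add_distrib, neg_mul]
      _ ≤ ∑ _q : κ, (2 * (2 ^ Fintype.card T * Real.exp (r ^ 2 / 2))) := by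
          refine Finset.sum_le_sum fun q _ => ?_
          rw [two_mul]
          exact add_le_add (hmgf r q rfl) (hmgf (-r) q (neg_sq r))
      _ = _ := by simp
  have hexp : Real.exp (r ^ 2) = Real.exp (r ^ 2 / 2) * Real.exp (r ^ 2 / 2) := by
    rw [← Real.exp_add, add_halves]
  rw [hexp] at hsum
  have hp : (0 : ℝ) < 2 ^ Fintype.card T * Real.exp (r ^ 2 / 2) := by positivity
  nlinarith

end Signs

/-! ### Nets and norms of multilinear forms -/

section Net

/-- The unit ball of a finite-dimensional real normed space has a `1/2`-net with at most
`5 ^ dim` points. -/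
lemma exists_half_net (E : Type*) [NormedAddCommGroup E] [NormedSpace ℝ E]
    [FiniteDimensional ℝ E] :
    ∃ N : Finset E, (∀ c ∈ N, ‖c‖ ≤ 1) ∧ N.card ≤ 5 ^ Module.finrank ℝ E ∧
      ∀ x : E, ‖x‖ ≤ 1 → ∃ c ∈ N, ‖x - c‖ ≤ 1 / 2 := by
  classical
  -- A `1/2`-separated subset of the ball of maximal cardinality is a net. Doubling makes it
  -- `1`-separated in the ball of radius `2`, where the volume bound is `5 ^ dim`.
  let p : Finset E → Prop := fun s =>
    (∀ c ∈ s, ‖c‖ ≤ 1) ∧ ∀ c ∈ s, ∀ d ∈ s, c ≠ d → 1 / 2 ≤ ‖c - d‖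
  have hcard : ∀ s, p s → s.card ≤ 5 ^ Module.finrank ℝ E := by
    rintro s ⟨h1, h2⟩
    have hinj : Function.Injective (fun x : E => (2 : ℝ) • x) :=
      smul_right_injective E two_ne_zero
    rw [← Finset.card_image_of_injective s hinj]
    refine Besicovitch.card_le_of_separated _ ?_ ?_
    · simp only [Finset.mem_image, forall_exists_index, and_imp, forall_apply_eq_imp_iff₂]
      intro c hc
      rw [norm_smul, Real.norm_ofNat]
      linarith [h1 c hc]
    · simp only [Finset.mem_image, forall_exists_index, and_imp, forall_apply_eq_imp_iff₂]
      intro c hc d hd hcd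
      rw [← smul_sub, norm_smul, Real.norm_ofNat]
      linarith [h2 c hc d hd (fun h => hcd (by rw [h]))]
  obtain ⟨N, hN, hmax⟩ : ∃ N, p N ∧ ∀ s, p s → s.card ≤ N.card := by
    have hne : {k | ∃ s, p s ∧ s.card = k}.Nonempty := ⟨0, ∅, ⟨by simp, by simp⟩, rfl⟩
    have hbdd : BddAbove {k | ∃ s, p s ∧ s.card = k} :=
      ⟨_, by rintro _ ⟨s, hs, rfl⟩; exact hcard s hs⟩
    obtain ⟨N, hN, hNk⟩ := Nat.sSup_mem hne hbdd
    exact ⟨N, hN, fun s hs => hNk ▸ le_csSup hbdd ⟨s, hs, rfl⟩⟩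
  refine ⟨N, hN.1, hcard N hN, fun x hx => ?_⟩
  by_contra! hfar
  have hxN : x ∉ N := fun h => by
    have := hfar x h
    norm_num at this
  have hins : p (insert x N) := by
    refine ⟨fun c hc => ?_, fun c hc d hd hcd => ?_⟩
    · rcases Finset.mem_insert.1 hc with rfl | hc
      exacts [hx, hN.1 c hc]
    · rcases Finset.mem_insert.1 hc with hcx | hcN <;>
        rcases Finset.mem_insert.1 hd with hdx | hdN
      · exact absurd (hcx.trans hdx.symm) hcd
      · rw [hcx]; exact (hfar d hdN).le
      · rw [hdx, norm_sub_rev]; exact (hfar c hcN).le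
      · exact hN.2 c hcN d hdN hcd
  have := hmax _ hins
  rw [Finset.card_insert_of_notMem hxN] at this
  omega

variable {E : Type*} [NormedAddCommGroup E] [NormedSpace ℂ E] [FiniteDimensional ℂ E]
  {N : Set E}

/-- Approximating by a net point gives `‖f‖ ≤ B + ‖f‖ / 2`; the last term is absorbed, as `‖f‖` is
finite. -/
lemma LinearMap.norm_le_two_mul_of_half_net (f : E →ₗ[ℂ] ℂ)
    (hN : ∀ x : E, ‖x‖ ≤ 1 → ∃ c ∈ N, ‖x - c‖ ≤ 1 / 2) {B : ℝ} (hf : ∀ c ∈ N, ‖f c‖ ≤ B)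
    {x : E} (hx : ‖x‖ ≤ 1) : ‖f x‖ ≤ 2 * B := by
  set g := LinearMap.toContinuousLinearMap f
  have hgf : ∀ y, g y = f y := fun y => rfl
  have hB : 0 ≤ B := by
    obtain ⟨c, hc, -⟩ := hN 0 (by simp)
    exact (norm_nonneg _).trans (hf c hc)
  have hg : ‖g‖ ≤ B + ‖g‖ * (1 / 2) := by
    refine ContinuousLinearMap.opNorm_le_of_unit_norm (𝕜 := ℂ) (by positivity) fun y hy => ?_
    obtain ⟨c, hc, hyc⟩ := hN y hy.le
    calc ‖g y‖ = ‖f c + g (y - c)‖ := by rw [map_sub, hgf c]; congr 1; ring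
      _ ≤ ‖f c‖ + ‖g (y - c)‖ := norm_add_le _ _
      _ ≤ B + ‖g‖ * (1 / 2) := add_le_add (hf c hc)
          ((g.le_opNorm _).trans (by gcongr))
  calc ‖f x‖ = ‖g x‖ := rfl
    _ ≤ ‖g‖ * ‖x‖ := g.le_opNorm x
    _ ≤ ‖g‖ * 1 := by gcongr
    _ ≤ 2 * B := by linarith

/-- The variables are released from the net one at a time, each at the cost of a factor `2`. -/
lemma MultilinearMap.norm_le_of_half_net {ι : Type*} [Fintype ι] [DecidableEq ι]
    (A : MultilinearMap ℂ (fun _ : ι => E) ℂ)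
    (hN : ∀ x : E, ‖x‖ ≤ 1 → ∃ c ∈ N, ‖x - c‖ ≤ 1 / 2) {B : ℝ}
    (hA : ∀ x : ι → E, (∀ j, x j ∈ N) → ‖A x‖ ≤ B) {x : ι → E} (hx : ∀ j, ‖x j‖ ≤ 1) :
    ‖A x‖ ≤ 2 ^ Fintype.card ι * B := by
  have key : ∀ (S : Finset ι) (x : ι → E), (∀ j ∈ S, ‖x j‖ ≤ 1) → (∀ j ∉ S, x j ∈ N) →
      ‖A x‖ ≤ 2 ^ S.card * B := by
    intro S
    induction S using Finset.induction_on with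
    | empty => intro x _ h; simpa using hA x (fun j => h j (by simp))
    | insert i S hi ih =>
      intro x h1 h2
      have h := (A.toLinearMap x i).norm_le_two_mul_of_half_net hN (B := 2 ^ S.card * B) ?_
        (h1 i (Finset.mem_insert_self i S))
      · rw [Finset.card_insert_of_notMem hi, pow_succ']
        simpa [mul_assoc] using h
      · intro c hc
        refine ih _ (fun j hj => ?_) (fun j hj => ?_)
        · have hji : j ≠ i := fun h => hi (h ▸ hj)
          simpa [Function.update_of_ne hji] using h1 j (Finset.mem_insert_of_mem hj)
        · by_cases hji : j = i
          · subst hji; simpa using hc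
          · rw [Function.update_of_ne hji]
            exact h2 j (by simp [hji, hj])
  simpa using key Finset.univ x (fun j _ => hx j) (by simp)

end Net

/-! ### Random sign forms on `ℓ_pⁿ` -/

section SignForm

variable {ι : Type*} [Fintype ι] [DecidableEq ι] {n : ℕ}

/-- The multilinear form on `(ℂⁿ)^ι` with the signs `ε` as coefficients. -/
def signForm (ε : (ι → Fin n) → ℤˣ) (x : ι → Fin n → ℂ) : ℂ :=
  ∑ s, ((ε s : ℤ) : ℂ) * ∏ j, x j (s j)

lemma norm_intUnit_cast (u : ℤˣ) : ‖((u : ℤ) : ℂ)‖ = 1 := by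
  rcases Int.units_eq_one_or u with rfl | rfl <;> simp

lemma norm_signForm_le_prod_sum (ε : (ι → Fin n) → ℤˣ) (x : ι → Fin n → ℂ) :
    ‖signForm ε x‖ ≤ ∏ j, ∑ i, ‖x j i‖ := by
  rw [Finset.prod_univ_sum, Fintype.piFinset_univ]
  refine (norm_sum_le _ _).trans (Finset.sum_le_sum fun s _ => ?_)
  rw [norm_mul, norm_intUnit_cast, one_mul, norm_prod]

lemma signForm_smul (ε : (ι → Fin n) → ℤˣ) (x : ι → Fin n → ℂ) (a : ℂ) :
    signForm ε (fun j i => a * x j i) = a ^ Fintype.card ι * signForm ε x := by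
  simp only [signForm, Finset.prod_mul_distrib, Finset.prod_const, Finset.card_univ,
    Finset.mul_sum]
  exact Finset.sum_congr rfl fun s _ => by ring

/-- `signForm` as a multilinear map on Euclidean space. -/
noncomputable def signMultilinear (ε : (ι → Fin n) → ℤˣ) :
    MultilinearMap ℂ (fun _ : ι => EuclideanSpace ℂ (Fin n)) ℂ :=
  ∑ s : ι → Fin n, ((ε s : ℤ) : ℂ) • (MultilinearMap.mkPiAlgebra ℂ ι ℂ).compLinearMap
    (fun j => (EuclideanSpace.proj (𝕜 := ℂ) (s j)).toLinearMap)

lemma signMultilinear_apply (ε : (ι → Fin n) → ℤˣ) (x : ι → EuclideanSpace ℂ (Fin n)) :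
    signMultilinear ε x = signForm ε (fun j i => x j i) := by
  simp [signMultilinear, signForm]

/-- The constant in the Euclidean bound for random sign forms. -/
noncomputable def signConst (M : ℕ) : ℝ := 2 ^ M * (2 * √(12 * M))

lemma one_le_signConst {M : ℕ} (hM : 0 < M) : 1 ≤ signConst M := by
  have h1 : (1 : ℝ) ≤ 2 ^ M := one_le_pow₀ one_le_two
  have h2 : (1 : ℝ) ≤ √(12 * M) := by
    rw [Real.one_le_sqrt]
    have : (1 : ℝ) ≤ M := by exact_mod_cast hM
    linarith
  unfold signConst
  nlinarith

/-- The union bound with `k = nM`: `5 ^ (2k)` bounds the number of net tuples, and `4` counts two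
tails for each of the real and imaginary parts. -/
lemma four_mul_five_pow_lt_exp {k : ℕ} (hk : 0 < k) :
    4 * (5 : ℝ) ^ (2 * k) < Real.exp (6 * k) := by
  have he : (5 : ℝ) < Real.exp 2 := by
    have h1 := Real.exp_one_gt_d9
    have h2 : Real.exp 2 = Real.exp 1 * Real.exp 1 := by rw [← Real.exp_add]; norm_num
    nlinarith
  have h3 : Real.exp (6 * k) = Real.exp 2 ^ k * Real.exp 2 ^ (2 * k) := by
    rw [← pow_add, ← Real.exp_nat_mul]
    congr 1; push_cast; ring
  rw [h3]
  have h4 : (4 : ℝ) < Real.exp 2 ^ k := by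
    calc (4 : ℝ) < Real.exp 2 := by linarith
      _ ≤ Real.exp 2 ^ k := le_self_pow₀ (by linarith) hk.ne'
  have h5 : (5 : ℝ) ^ (2 * k) ≤ Real.exp 2 ^ (2 * k) := by gcongr
  exact mul_lt_mul h4 h5 (by positivity) (by positivity)

/-- Some form with coefficients `±1` has norm `O(√n)` on Euclidean space. -/
lemma exists_signForm_le_euclidean (hn : 0 < n) [Nonempty ι] :
    ∃ ε : (ι → Fin n) → ℤˣ, ∀ x : ι → Fin n → ℂ, (∀ j, ∑ i, ‖x j i‖ ^ 2 ≤ 1) →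
      ‖signForm ε x‖ ≤ signConst (Fintype.card ι) * √n := by
  classical
  obtain ⟨N, hN1, hNcard, hNnet⟩ := exists_half_net (EuclideanSpace ℂ (Fin n))
  have hrank : Module.finrank ℝ (EuclideanSpace ℂ (Fin n)) = 2 * n := by
    rw [finrank_real_of_complex, finrank_euclideanSpace_fin]
  rw [hrank] at hNcard
  set M := Fintype.card ι
  have hM : 0 < M := Fintype.card_pos
  let w : (ι → N) → (ι → Fin n) → ℂ := fun q s => ∏ j, (q j : EuclideanSpace ℂ (Fin n)) (s j)
  let c : (ι → N) × Bool → (ι → Fin n) → ℝ := fun q s =>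
    bif q.2 then (w q.1 s).re else (w q.1 s).im
  have hw : ∀ q, ∑ s, ‖w q s‖ ^ 2 ≤ 1 := by
    intro q
    have : ∑ s, ‖w q s‖ ^ 2 = ∏ j, ∑ i, ‖(q j : EuclideanSpace ℂ (Fin n)) i‖ ^ 2 := by
      rw [Finset.prod_univ_sum, Fintype.piFinset_univ]
      simp [w, norm_prod, Finset.prod_pow]
    rw [this]
    refine Finset.prod_le_one (fun j _ => by positivity) fun j _ => ?_
    rw [← EuclideanSpace.norm_sq_eq]
    exact pow_le_one₀ (norm_nonneg _) (hN1 _ (q j).2)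
  have hc : ∀ q, ∑ s, c q s ^ 2 ≤ 1 := by
    rintro ⟨q, b⟩
    refine (Finset.sum_le_sum fun s _ => ?_).trans (hw q)
    rw [← sq_abs]
    cases b
    · exact pow_le_pow_left₀ (abs_nonneg _) (Complex.abs_im_le_norm _) 2
    · exact pow_le_pow_left₀ (abs_nonneg _) (Complex.abs_re_le_norm _) 2
  -- This `r` makes `r² / 2 = 6nM`, enough to beat the net count.
  obtain ⟨ε, hε⟩ := exists_signs_abs_sum_le c hc (r := √(12 * M) * √n) (by positivity) (by
    have hr : (√(12 * M) * √n) ^ 2 / 2 = 6 * ((n * M : ℕ) : ℝ) := by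
      rw [mul_pow, Real.sq_sqrt (by positivity), Real.sq_sqrt (by positivity)]
      push_cast; ring
    rw [hr]
    refine lt_of_le_of_lt ?_ (four_mul_five_pow_lt_exp (Nat.mul_pos hn hM))
    have hcard : Fintype.card ((ι → N) × Bool) = N.card ^ M * 2 := by
      simp [M]
    have h5 : ((N.card : ℝ)) ^ M ≤ 5 ^ (2 * (n * M)) := by
      rw [← mul_assoc, pow_mul]
      exact pow_le_pow_left₀ (Nat.cast_nonneg _) (by exact_mod_cast hNcard) M
    rw [hcard]; push_cast; linarith)
  refine ⟨ε, fun x hx => ?_⟩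
  have hnet : ∀ y : ι → EuclideanSpace ℂ (Fin n), (∀ j, y j ∈ (N : Set _)) →
      ‖signMultilinear ε y‖ ≤ 2 * (√(12 * M) * √n) := by
    intro y hy
    let q : ι → N := fun j => ⟨y j, hy j⟩
    have hval : signMultilinear ε y = ∑ s, ((ε s : ℤ) : ℂ) * w q s := by
      rw [signMultilinear_apply]; rfl
    have hre := hε (q, true)
    have him := hε (q, false)
    rw [hval]
    refine (Complex.norm_le_abs_re_add_abs_im _).trans ?_
    rw [two_mul]
    refine add_le_add ?_ ?_
    · simpa [c, Complex.re_sum] using hre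
    · simpa [c, Complex.im_sum] using him
  have hball := (signMultilinear ε).norm_le_of_half_net (N := (N : Set _)) hNnet hnet
    (x := fun j => WithLp.toLp 2 (x j)) (fun j => by
      rw [← sq_le_one_iff₀ (norm_nonneg _), EuclideanSpace.norm_sq_eq]
      exact hx j)
  rw [signMultilinear_apply] at hball
  calc _ ≤ _ := hball
    _ = _ := by simp only [signConst, M]; ring

/-- Rescaled version of a bound on the Euclidean unit ball. -/
lemma norm_signForm_le_of_euclidean {ε : (ι → Fin n) → ℤˣ} {B : ℝ}
    (hε : ∀ x : ι → Fin n → ℂ, (∀ j, ∑ i, ‖x j i‖ ^ 2 ≤ 1) → ‖signForm ε x‖ ≤ B)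
    {R : ℝ} (hR : 0 < R) {x : ι → Fin n → ℂ} (hx : ∀ j, ∑ i, ‖x j i‖ ^ 2 ≤ R ^ 2) :
    ‖signForm ε x‖ ≤ B * R ^ Fintype.card ι := by
  have h1 := hε (fun j i => (R⁻¹ : ℂ) * x j i) fun j => by
    simp_rw [norm_mul, mul_pow, ← Finset.mul_sum]
    rw [norm_inv, Complex.norm_real, Real.norm_of_nonneg hR.le, inv_pow,
      inv_mul_le_one₀ (by positivity)]
    exact hx j
  rw [signForm_smul, norm_mul, norm_pow, norm_inv, Complex.norm_real,
    Real.norm_of_nonneg hR.le, inv_pow, inv_mul_le_iff₀ (by positivity)] at h1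
  linarith

/-- Comparison of `ℓ_p` with `ℓ_2` for `p ≥ 2`. -/
lemma sum_sq_le_of_two_le (hn : 0 < n) {p : ℝ} (hp : 2 ≤ p) {v : Fin n → ℂ}
    (hv : ∑ i, ‖v i‖ ^ p ≤ 1) : ∑ i, ‖v i‖ ^ 2 ≤ ((n : ℝ) ^ (1 / 2 - p⁻¹)) ^ 2 := by
  have hp0 : 0 < p := by linarith
  have hn0 : (0 : ℝ) < n := by exact_mod_cast hn
  have h := Real.rpow_sum_le_const_mul_sum_rpow_of_nonneg (s := Finset.univ)
    (f := fun i => ‖v i‖ ^ 2) (p := p / 2) (by linarith) (fun i _ => by positivity)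
  have h2 : ∀ i, (‖v i‖ ^ 2) ^ (p / 2) = ‖v i‖ ^ p := fun i => by
    rw [← Real.rpow_natCast, ← Real.rpow_mul (norm_nonneg _)]
    congr 1; push_cast; ring
  simp_rw [h2] at h
  have h3 : (∑ i, ‖v i‖ ^ 2) ^ (p / 2) ≤ (n : ℝ) ^ (p / 2 - 1) := by
    refine h.trans ?_
    rw [Finset.card_univ, Fintype.card_fin]
    exact mul_le_of_le_one_right (by positivity) hv
  have h4 : (((n : ℝ) ^ (1 / 2 - p⁻¹)) ^ 2) ^ (p / 2) = (n : ℝ) ^ (p / 2 - 1) := by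
    rw [← Real.rpow_natCast, ← Real.rpow_mul hn0.le, ← Real.rpow_mul hn0.le]
    congr 1; push_cast; field_simp
  rw [← h4] at h3
  exact (Real.rpow_le_rpow_iff (by positivity) (by positivity) (by positivity)).1 h3

/-! ### Interpolation for `1 ≤ p ≤ 2` -/

/-- The analytic family through `a` used in the interpolation of `ℓ_p` between `ℓ_1` and `ℓ_2`. -/
noncomputable def interpPoint (p : ℝ) (a z : ℂ) : ℂ :=
  if a = 0 then 0 else a / ‖a‖ * (‖a‖ : ℂ) ^ ((p : ℂ) * (1 - z / 2))

lemma norm_interpPoint {p : ℝ} (a z : ℂ) (hp : 0 < p) (hz : z.re < 2) :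
    ‖interpPoint p a z‖ = ‖a‖ ^ (p * (1 - z.re / 2)) := by
  unfold interpPoint
  split_ifs with h
  · rw [h, norm_zero, Real.zero_rpow]
    have : 0 < 1 - z.re / 2 := by linarith
    positivity
  · have ha : 0 < ‖a‖ := norm_pos_iff.2 h
    rw [norm_mul, norm_div, Complex.norm_real, norm_norm, div_self ha.ne', one_mul,
      Complex.norm_cpow_eq_rpow_re_of_pos ha]
    simp

lemma differentiable_interpPoint (p : ℝ) (a : ℂ) : Differentiable ℂ (interpPoint p a) := by
  unfold interpPoint
  split_ifs with h
  · fun_prop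
  · have ha : (‖a‖ : ℂ) ≠ 0 := by simpa using h
    refine Differentiable.const_mul ?_ _
    exact Differentiable.const_cpow (by fun_prop) (Or.inl ha)

lemma interpPoint_self {p : ℝ} (hp : p ≠ 0) (a : ℂ) :
    interpPoint p a ((2 * (1 - p⁻¹) : ℝ) : ℂ) = a := by
  unfold interpPoint
  split_ifs with h
  · exact h.symm
  · have ha : (‖a‖ : ℂ) ≠ 0 := by simpa using h
    have hp' : (p : ℂ) ≠ 0 := by exact_mod_cast hp
    have : (p : ℂ) * (1 - ((2 * (1 - p⁻¹) : ℝ) : ℂ) / 2) = 1 := by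
      push_cast; field_simp; ring
    rw [this, Complex.cpow_one, div_mul_cancel₀ _ ha]

open Complex.HadamardThreeLines in
/-- Interpolation between the trivial bound on `ℓ_1` and a bound on `ℓ_2`. -/
lemma norm_signForm_le_interp {ε : (ι → Fin n) → ℤˣ} {B : ℝ}
    (hε : ∀ x : ι → Fin n → ℂ, (∀ j, ∑ i, ‖x j i‖ ^ 2 ≤ 1) → ‖signForm ε x‖ ≤ B)
    {p : ℝ} (hp1 : 1 ≤ p) (hp2 : p ≤ 2) {x : ι → Fin n → ℂ}
    (hx : ∀ j, ∑ i, ‖x j i‖ ^ p ≤ 1) : ‖signForm ε x‖ ≤ B ^ (2 * (1 - p⁻¹)) := by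
  have hp0 : 0 < p := by linarith
  -- The modulus exponent `p (1 - Re z / 2)` is `p` on `Re z = 0` (an `ℓ₁` vector), `p / 2` on `Re z
  -- = 1` (an `ℓ₂` vector), and `1` at `z = θ`.
  set θ : ℝ := 2 * (1 - p⁻¹)
  have hθ0 : 0 ≤ θ := by
    have : p⁻¹ ≤ 1 := inv_le_one_of_one_le₀ hp1
    simp only [θ]; linarith
  have hθ1 : θ ≤ 1 := by
    have : (2 : ℝ)⁻¹ ≤ p⁻¹ := inv_anti₀ hp0 hp2
    simp only [θ]; linarith
  let F : ℂ → ℂ := fun z => signForm ε (fun j i => interpPoint p (x j i) z)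
  have hFθ : F θ = signForm ε x := by
    simp only [F, θ, interpPoint_self hp0.ne']
  have hF : Differentiable ℂ F := by
    have := differentiable_interpPoint p
    unfold F signForm
    fun_prop
  have hx1 : ∀ j i, ‖x j i‖ ≤ 1 := by
    intro j i
    by_contra! h
    have h1 := Real.one_lt_rpow h hp0
    have h2 := Finset.single_le_sum (f := fun i => ‖x j i‖ ^ p) (fun i _ => by positivity)
      (Finset.mem_univ i)
    linarith [hx j]
  have h3 := norm_le_interp_of_mem_verticalClosedStrip₀₁' F (z := (θ : ℂ)) (a := 1) (b := B)
    (by simp [verticalClosedStrip, hθ0, hθ1]) hF.diffContOnCl ?_ ?_ ?_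
  · simpa [hFθ] using h3
  · refine ⟨∏ _j : ι, ∑ _i : Fin n, (1 : ℝ), ?_⟩
    rintro _ ⟨z, hz, rfl⟩
    have hz' : z.re ≤ 1 := hz.2
    refine (norm_signForm_le_prod_sum _ _).trans ?_
    gcongr with j _ i _
    rw [norm_interpPoint _ _ hp0 (by linarith)]
    refine Real.rpow_le_one (norm_nonneg _) (hx1 j i) (mul_nonneg hp0.le ?_)
    linarith
  · intro z hz
    have hz' : z.re = 0 := hz
    refine (norm_signForm_le_prod_sum _ _).trans
      (Finset.prod_le_one (fun j _ => by positivity) fun j _ => ?_)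
    refine le_trans (le_of_eq (Finset.sum_congr rfl fun i _ => ?_)) (hx j)
    rw [norm_interpPoint _ _ hp0 (by linarith), hz']
    simp
  · intro z hz
    have hz' : z.re = 1 := hz
    refine hε _ fun j => ?_
    refine le_trans (le_of_eq (Finset.sum_congr rfl fun i _ => ?_)) (hx j)
    rw [norm_interpPoint _ _ hp0 (by linarith), hz', ← Real.rpow_natCast,
      ← Real.rpow_mul (norm_nonneg _)]
    congr 1; push_cast; ring

/-- Some form with coefficients `±1` has small norm on all `ℓ_pⁿ`, `1 ≤ p ≤ ∞`. -/
lemma exists_signForm_le (hn : 0 < n) [Nonempty ι] :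
    ∃ ε : (ι → Fin n) → ℤˣ, ∀ (p : ℝ≥0∞), 1 ≤ p → ∀ x : ι → Fin n → ℂ,
      (p = ⊤ → ∀ j i, ‖x j i‖ ≤ 1) → (p ≠ ⊤ → ∀ j, ∑ i, ‖x j i‖ ^ p.toReal ≤ 1) →
      ‖signForm ε x‖ ≤ signConst (Fintype.card ι) * (n : ℝ) ^
        max ((Fintype.card ι : ℝ) * (1 / 2 - (p⁻¹).toReal) + 1 / 2) (1 - (p⁻¹).toReal) := by
  obtain ⟨ε, hε⟩ := exists_signForm_le_euclidean (ι := ι) hn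
  refine ⟨ε, fun p hp x htop hfin => ?_⟩
  have hn1 : (1 : ℝ) ≤ n := by exact_mod_cast hn
  have hn0 : (0 : ℝ) < n := by linarith
  have hK : 1 ≤ signConst (Fintype.card ι) := one_le_signConst Fintype.card_pos
  have hK0 : 0 ≤ signConst (Fintype.card ι) := by linarith
  have large : (∀ j, ∑ i, ‖x j i‖ ^ 2 ≤ ((n : ℝ) ^ (1 / 2 - (p⁻¹).toReal)) ^ 2) →
      ‖signForm ε x‖ ≤ signConst (Fintype.card ι) * (n : ℝ) ^
        max ((Fintype.card ι : ℝ) * (1 / 2 - (p⁻¹).toReal) + 1 / 2) (1 - (p⁻¹).toReal) := by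
    intro h
    calc _ ≤ _ := norm_signForm_le_of_euclidean hε (by positivity) h
      _ = signConst (Fintype.card ι) *
          (n : ℝ) ^ ((Fintype.card ι : ℝ) * (1 / 2 - (p⁻¹).toReal) + 1 / 2) := by
        rw [Real.rpow_add hn0, ← Real.sqrt_eq_rpow, mul_comm (Fintype.card ι : ℝ),
          Real.rpow_mul hn0.le, Real.rpow_natCast]
        ring
      _ ≤ _ := by
        gcongr
        exact le_max_left _ _
  by_cases hpt : p = ⊤
  · refine large fun j => ?_
    calc ∑ i, ‖x j i‖ ^ 2 ≤ ∑ _i : Fin n, (1 : ℝ) :=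
          Finset.sum_le_sum fun i _ => pow_le_one₀ (norm_nonneg _) (htop hpt j i)
      _ = ((n : ℝ) ^ (1 / 2 - (p⁻¹).toReal)) ^ 2 := by
          simp [hpt, ← Real.rpow_natCast, ← Real.rpow_mul hn0.le]
  have hpr : 1 ≤ p.toReal := by
    rw [← ENNReal.toReal_one]
    exact ENNReal.toReal_mono hpt hp
  rw [ENNReal.toReal_inv] at large ⊢
  rcases le_total 2 p.toReal with h2 | h2
  · exact large fun j => sum_sq_le_of_two_le hn h2 (hfin hpt j)
  · have hinv1 : p.toReal⁻¹ ≤ 1 := inv_le_one_of_one_le₀ hpr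
    have hinv2 : (2 : ℝ)⁻¹ ≤ p.toReal⁻¹ := inv_anti₀ (by linarith) h2
    calc _ ≤ _ := norm_signForm_le_interp hε hpr h2 (hfin hpt)
      _ = signConst (Fintype.card ι) ^ (2 * (1 - p.toReal⁻¹)) * (n : ℝ) ^ (1 - p.toReal⁻¹) := by
        rw [Real.mul_rpow hK0 (by positivity), Real.sqrt_eq_rpow, ← Real.rpow_mul hn0.le]
        congr 2; ring
      -- The interpolation exponent is at most `1` and the constant at least `1`, so the constant
      -- stays independent of `p`.
      _ ≤ signConst (Fintype.card ι) ^ (1 : ℝ) * (n : ℝ) ^ (1 - p.toReal⁻¹) := by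
        gcongr
        linarith
      _ ≤ _ := by
        rw [Real.rpow_one]
        gcongr
        exact le_max_right _ _

end SignForm

/-! ### From multilinear forms to multihomogeneous polynomials -/

section BlockForms

/-- Every `RCLike` field embeds isometrically into `ℂ`. -/
lemma RCLike.exists_isometric_ringHom_complex (𝕂 : Type*) [RCLike 𝕂] :
    ∃ φ : 𝕂 →+* ℂ, ∀ a, ‖φ a‖ = ‖a‖ := by
  rcases RCLike.I_eq_zero_or_im_I_eq_one (K := 𝕂) with h | h
  · exact ⟨Complex.ofRealHom.comp (RCLike.realRingEquiv h).toRingHom, fun a =>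
      (Complex.norm_real _).trans ((RCLike.realLinearIsometryEquiv h).norm_map a)⟩
  · exact ⟨(RCLike.complexRingEquiv h).toRingHom,
      fun a => (RCLike.complexLinearIsometryEquiv h).norm_map a⟩

variable {m : ℕ} {d : Fin m → ℕ}

/-- Places the values of the `k`-th index of every block in the `k`-th interval of length `n`. -/
def blockEmbedding (d : Fin m → ℕ) (n : ℕ) :
    (((j : Fin m) × Fin (d j)) → Fin n) ↪ BlockIndex d where
  toFun s a := a.2 * n + s a
  inj' s s' h := by
    funext a
    have := congrFun h a
    simp only [add_right_inj] at this
    exact Fin.ext this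

lemma blockEmbedding_apply {n : ℕ} (s : ((j : Fin m) × Fin (d j)) → Fin n)
    (a : (j : Fin m) × Fin (d j)) : blockEmbedding d n s a = a.2 * n + s a := rfl

lemma blockEmbedding_div {n : ℕ} (hn : 0 < n) (s : ((j : Fin m) × Fin (d j)) → Fin n)
    (a : (j : Fin m) × Fin (d j)) : blockEmbedding d n s a / n = a.2 := by
  rw [blockEmbedding_apply, mul_comm, Nat.mul_add_div hn, Nat.div_eq_of_lt (s a).2, add_zero]

/-- An index value divided by `n` reveals its slot in the block, so the unordered monomial recovers
the ordered tuple. -/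
lemma injOn_multiIndex_range_blockEmbedding {n : ℕ} (hn : 0 < n) :
    Set.InjOn BlockIndex.multiIndex (Set.range (blockEmbedding d n)) := by
  rintro _ ⟨s, rfl⟩ _ ⟨s', rfl⟩ h
  funext ⟨j, k⟩
  set v := blockEmbedding d n s ⟨j, k⟩ with hv
  have hpos : 0 < (blockEmbedding d n s).multiIndex j v :=
    Finset.card_pos.2 ⟨k, by simp [hv]⟩
  rw [h] at hpos
  obtain ⟨k', hk'⟩ := Finset.card_pos.1 hpos
  have hk'v : blockEmbedding d n s' ⟨j, k'⟩ = v := (Finset.mem_filter.1 hk').2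
  have hkk : k = k' := by
    have h1 := blockEmbedding_div hn s ⟨j, k⟩
    have h2 := blockEmbedding_div hn s' ⟨j, k'⟩
    rw [hk'v] at h2
    exact Fin.ext (h1.symm.trans h2)
  rw [hkk, hk'v]

lemma isMultiHomogeneousPoly_sum_monomials {𝕂 : Type*} [RCLike 𝕂] {p : ℝ≥0∞} [Fact (1 ≤ p)]
    (S : Finset (BlockIndex d)) (a : BlockIndex d → 𝕂) :
    IsMultiHomogeneousPoly 𝕂 d (fun x : Fin m → lp (fun _ : ℕ => 𝕂) p =>
      ∑ t ∈ S, a t * ∏ j : Fin m, ∏ k : Fin (d j), x j (t ⟨j, k⟩)) := by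
  intro i x
  refine ⟨∑ t ∈ S, (a t * ∏ j ∈ Finset.univ.erase i, ∏ k : Fin (d j), x j (t ⟨j, k⟩)) •
    (MultilinearMap.mkPiAlgebra 𝕂 (Fin (d i)) 𝕂).compLinearMap
      (fun k => lp.evalₗ (𝕜 := 𝕂) (fun _ : ℕ => 𝕂) p (t ⟨i, k⟩)), fun y => ?_⟩
  rw [sum_apply]
  refine Finset.sum_congr rfl fun t _ => ?_
  rw [← Finset.mul_prod_erase _ _ (Finset.mem_univ i), Function.update_self]
  have : ∏ j ∈ Finset.univ.erase i, ∏ k : Fin (d j), (Function.update x i y j) (t ⟨j, k⟩) =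
      ∏ j ∈ Finset.univ.erase i, ∏ k : Fin (d j), x j (t ⟨j, k⟩) :=
    Finset.prod_congr rfl fun j hj => by rw [Function.update_of_ne (Finset.ne_of_mem_erase hj)]
  rw [this]
  simp only [smul_apply, MultilinearMap.compLinearMap_apply,
    MultilinearMap.mkPiAlgebra_apply, lp.evalₗ_apply, smul_eq_mul]
  ring

lemma lp.sum_norm_rpow_comp_le_one {𝕂 : Type*} [RCLike 𝕂] {p : ℝ≥0∞} [Fact (1 ≤ p)]
    (hp : p ≠ ⊤) {α : Type*} [Fintype α] (e : α ↪ ℕ) {y : lp (fun _ : ℕ => 𝕂) p}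
    (hy : ‖y‖ ≤ 1) : ∑ i, ‖y (e i)‖ ^ p.toReal ≤ 1 := by
  have hp0 : 0 < p.toReal :=
    ENNReal.toReal_pos (zero_lt_one.trans_le (Fact.out : 1 ≤ p)).ne' hp
  have h := lp.sum_rpow_le_norm_rpow hp0 y (Finset.univ.map e)
  rw [Finset.sum_map] at h
  exact h.trans (Real.rpow_le_one (norm_nonneg _) hy hp0.le)

end BlockForms

/-- The constant `C M` depends only on `M = d₁ + ⋯ + dₘ`. By the injectivity clause no two of the
tuples with a nonzero coefficient give the same monomial in commuting variables, so the nonzero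
`δ t` are the nonzero coefficients of the monomial expansion of `Q`. -/
theorem theorem2p4 :
    ∃ C : ℕ → ℝ,
      ∀ (𝕂 : Type*) [RCLike 𝕂] (n m : ℕ) (d : Fin m → ℕ) (p : ℝ≥0∞) [Fact (1 ≤ p)],
        0 < n → 0 < m → (∀ j, 0 < d j) →
        ∃ (Q : (Fin m → lp (fun _ : ℕ => 𝕂) p) → 𝕂) (δ : BlockIndex d →₀ ℤ),
          IsMultiHomogeneousPoly 𝕂 d Q ∧
          (∀ x : Fin m → lp (fun _ : ℕ => 𝕂) p,
            Q x = ∑ t ∈ δ.support, (δ t : 𝕂) * ∏ j : Fin m, ∏ k : Fin (d j), x j (t ⟨j, k⟩)) ∧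
          (∀ t, δ t = 0 ∨ δ t = 1 ∨ δ t = -1) ∧
          Set.InjOn BlockIndex.multiIndex (δ.support : Set (BlockIndex d)) ∧
          δ.support.card = n ^ (∑ j, d j) ∧
          multipolyNorm Q ≤ ENNReal.ofReal
            (C (∑ j, d j) * (n : ℝ) ^
              max (((∑ j, d j : ℕ) : ℝ) * (1 / 2 - (p⁻¹).toReal) + 1 / 2)
                (1 - (p⁻¹).toReal)) := by
  refine ⟨signConst, fun 𝕂 _ n m d p hp hn hm hd => ?_⟩
  have hcard : Fintype.card ((j : Fin m) × Fin (d j)) = ∑ j, d j := by simp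
  have : Nonempty ((j : Fin m) × Fin (d j)) := ⟨⟨⟨0, hm⟩, ⟨0, hd _⟩⟩⟩
  obtain ⟨ε, hε⟩ := exists_signForm_le (ι := (j : Fin m) × Fin (d j)) hn
  obtain ⟨φ, hφ⟩ := RCLike.exists_isometric_ringHom_complex 𝕂
  let τ := blockEmbedding d n
  let δ : BlockIndex d →₀ ℤ :=
    Finsupp.embDomain τ (Finsupp.equivFunOnFinite.symm fun s => (ε s : ℤ))
  have hδτ : ∀ s, δ (τ s) = ε s := fun s => by simp [δ, Finsupp.embDomain_apply_self]
  have hsupp : δ.support = Finset.univ.map τ := by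
    rw [Finsupp.support_embDomain]
    congr 1
    ext s
    simp
  refine ⟨_, δ, isMultiHomogeneousPoly_sum_monomials δ.support (fun t => (δ t : 𝕂)),
    fun x => rfl, fun t => ?_, ?_, ?_, ?_⟩
  · by_cases ht : t ∈ δ.support
    · rw [hsupp, Finset.mem_map] at ht
      obtain ⟨s, -, rfl⟩ := ht
      rw [hδτ]
      rcases Int.units_eq_one_or (ε s) with h | h <;> simp [h]
    · exact Or.inl (Finsupp.notMem_support_iff.1 ht)
  · have : (δ.support : Set (BlockIndex d)) = Set.range τ := by rw [hsupp]; simp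
    rw [this]
    exact injOn_multiIndex_range_blockEmbedding hn
  · rw [hsupp, Finset.card_map, Finset.card_univ, Fintype.card_fun, hcard, Fintype.card_fin]
  · refine iSup₂_le fun x hx => ?_
    rw [← ofReal_norm]
    refine ENNReal.ofReal_le_ofReal ?_
    -- Slot `(j, k)` sees only the `k`-th interval of `x j`, so `Q` is a value of the complex sign
    -- form.
    have hQ : φ (∑ t ∈ δ.support, (δ t : 𝕂) * ∏ j : Fin m, ∏ k : Fin (d j), x j (t ⟨j, k⟩)) =
        signForm ε (fun a i => φ (x a.1 (a.2 * n + i))) := by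
      rw [hsupp, Finset.sum_map, map_sum]
      refine Finset.sum_congr rfl fun s _ => ?_
      rw [hδτ, map_mul, map_intCast, map_prod, Fintype.prod_sigma]
      simp_rw [map_prod]
      rfl
    rw [← hφ, hQ, ← hcard]
    refine hε p hp.out _ (fun hpt a i => ?_) (fun hpt a => ?_)
    · rw [hφ]
      exact (lp.norm_apply_le_norm (zero_lt_one.trans_le hp.out).ne' _ _).trans (hx a.1)
    · simp_rw [hφ]
      exact lp.sum_norm_rpow_comp_le_one hpt
        ⟨fun i : Fin n => a.2 * n + i, fun i i' h => Fin.ext (Nat.add_left_cancel h)⟩ (hx a.1)
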